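/- **Theorem 3.3.** Let $\mathbf x_1,\dots,\mathbf x_N$ ($N\ge 1$) be i.i.d. centered random vectors in $\mathbb R^n$ (the values at $n$ fixed points of $N$ independent copies of a centered process), with covariance matrix $\Sigma=\mathbb E(\mathbf x_1\mathbf x_1^T)$, and put $\Phi=V(\mathrm{vec}(\mathbf x_1\mathbf x_1^T))$, the covariance matrix of the vector $\mathrm{vec}(\mathbf x_1\mathbf x_1^T)$. Throughout, $\|A\|=\sqrt{\mathrm{Tr}(AA^T)}$ is the Frobenius norm. Let $\mathcal M$ be a finite nonempty index set and, for each $m\in\mathcal M$, let $G_m$ be a real design matrix with $n$ rows and $k_m$ columns. Write $$\Pi_m=G_m(G_m^TG_m)^-G_m^T,\qquad D_m=\mathrm{Tr}(\Pi_m),\qquad \delta_m^2=\frac{\mathrm{Tr}\big((\Pi_m\otimes\Pi_m)\Phi\big)}{D_m},\qquad \delta_{\sup}^2=\max_{m\in\mathcal M}\delta_m^2,$$ where $(G_m^TG_m)^-$ is any generalized inverse of $G_m^TG_m$ (the inverse, if $G_m^TG_m$ is invertible; $A^-$ is a generalized inverse of $A$ if $AA^-A=A$), and assume $D_m\ge 1$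 and $\delta_m>0$ for all $m\in\mathcal M$. Let $\hat\Sigma_m$ be the least squares covariance estimator, i.e. the minimizer of $\frac1N\sum_{i=1}^N\|\mathbf x_i\mathbf x_i^T-\Gamma\|^2$ over all $\Gamma=G_m\Psi G_m^T$ with $\Psi$ a symmetric $k_m\times k_m$ matrix. Given $\theta>0$, let $\tilde\Sigma=\hat\Sigma_{\hat m}$, where $\hat m$ is a (measurable) random element of $\mathcal M$ that minimizes $$\frac1N\sum_{i=1}^N\big\|\mathbf x_i\mathbf x_i^T-\hat\Sigma_m\big\|^2+(1+\theta)\frac{\delta_m^2D_m}{N}$$ over $m\in\mathcal M$. Let $q>0$ and $p>2(1+q)$ be such that $\mathbb E\|\mathbf x_1\mathbf x_1^T\|^p<\infty$. Then there are constants $K(\theta)>1$, depending only on $\theta$, and $C'(\theta,p,q)>0$, depending only on $\theta,p,q$, such that $\mathbb E\|\Sigma-\tilde\Sigma\|^{2q}<\infty$ and $$\Big(\mathbb E\|\Sigma-\tilde\Sigma\|^{2q}\Big)^{1/q}\le 2^{(q^{-1}-1)_+}\Big[K(\theta)\inf_{m\in\mathcal M}\Big(\|\Sigma-\Pi_m\Sigma\Pi_m\|^2+\frac{\delta_m^2D_m}{N}\Big)+\frac{\Delta_p}{N}\,\delta_{\sup}^2\Big],$$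 where $\Delta_p\ge 0$ is given by $$\Delta_p^q=C'(\theta,p,q)\,\mathbb E\|\mathbf x_1\mathbf x_1^T\|^p\sum_{m\in\mathcal M}\delta_m^{-p}D_m^{-(p/2-1-q)}.$$ In particular, for $q=1$, with the same constants, all the second moments below are finite and $$\mathbb E\|\Sigma-\tilde\Sigma\|^2\le K(\theta)\inf_{m\in\mathcal M}\mathbb E\|\Sigma-\hat\Sigma_m\|^2+\frac{\Delta_p}{N}\,\delta_{\sup}^2 .$$ -/

import Mathlib

open MeasureTheory ProbabilityTheory
open scoped Matrix Kronecker BigOperators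

-- `‖A‖` for a real matrix `A` is the Frobenius norm.
attribute [local instance] Matrix.frobeniusNormedAddCommGroup

noncomputable section

namespace CovSel

/-- The rank-one matrix `v vᵀ`. -/
def outer {n : ℕ} (v : Fin n → ℝ) : Matrix (Fin n) (Fin n) ℝ :=
  Matrix.vecMulVec v v

/-- The covariance matrix `V(z)` of a random vector `z`. -/
def covMat {Ω κ : Type*} [MeasurableSpace Ω] (P : Measure Ω) (z : Ω → κ → ℝ) :
    Matrix κ κ ℝ :=
  Matrix.of fun a b => cov[fun ω => z ω a, fun ω => z ω b; P]

/-- `Φ = V(vec(x xᵀ))`. -/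
def Phi {Ω : Type*} [MeasurableSpace Ω] (P : Measure Ω) {n : ℕ} (x : Ω → Fin n → ℝ) :
    Matrix (Fin n × Fin n) (Fin n × Fin n) ℝ :=
  covMat P fun ω => Matrix.vec (outer (x ω))

/-- `H` is a generalized inverse of `A`. If `A` is invertible, this forces `H = A⁻¹`. -/
def IsGenInv {k : ℕ} (A H : Matrix (Fin k) (Fin k) ℝ) : Prop :=
  A * H * A = A

/-- `Π = G (Gᵀ G)⁻ Gᵀ`, where `H` plays the role of `(Gᵀ G)⁻`. -/
def proj {n k : ℕ} (G : Matrix (Fin n) (Fin k) ℝ) (H : Matrix (Fin k) (Fin k) ℝ) :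
    Matrix (Fin n) (Fin n) ℝ :=
  G * H * Gᵀ

/-- `D = Tr Π`. -/
def dimen {n : ℕ} (Pi : Matrix (Fin n) (Fin n) ℝ) : ℝ :=
  Pi.trace

/-- `δ² = Tr((Π ⊗ Π) Φ) / D`. -/
def deltaSq {n : ℕ} (Pi : Matrix (Fin n) (Fin n) ℝ)
    (Φ : Matrix (Fin n × Fin n) (Fin n × Fin n) ℝ) : ℝ :=
  ((Pi ⊗ₖ Pi) * Φ).trace / dimen Pi

/-- The set `S(G) = {G Ψ Gᵀ : Ψ symmetric}`. -/
def modelSet {n k : ℕ} (G : Matrix (Fin n) (Fin k) ℝ) : Set (Matrix (Fin n) (Fin n) ℝ) :=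
  {Γ | ∃ Ψ : Matrix (Fin k) (Fin k) ℝ, Ψ.IsSymm ∧ Γ = G * Ψ * Gᵀ}

/-- The empirical contrast `(1/N) ∑ᵢ ‖xᵢ xᵢᵀ - Γ‖²`. -/
def contrast {n N : ℕ} (x : Fin N → Fin n → ℝ) (Γ : Matrix (Fin n) (Fin n) ℝ) : ℝ :=
  (1 / (N : ℝ)) * ∑ i, ‖outer (x i) - Γ‖ ^ 2

/-- `Γ` is the least squares covariance estimate for the design matrix `G` and the data `x`:
it minimizes the empirical contrast over `S(G)`. -/
def IsLeastSquares {n N k : ℕ} (G : Matrix (Fin n) (Fin k) ℝ) (x : Fin N → Fin n → ℝ)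
    (Γ : Matrix (Fin n) (Fin n) ℝ) : Prop :=
  Γ ∈ modelSet G ∧ ∀ Γ' ∈ modelSet G, contrast x Γ ≤ contrast x Γ'

/-- The penalty `(1 + θ) δ² D / N`. -/
def pen {n : ℕ} (θ : ℝ) (N : ℕ) (Pi : Matrix (Fin n) (Fin n) ℝ)
    (Φ : Matrix (Fin n × Fin n) (Fin n × Fin n) ℝ) : ℝ :=
  (1 + θ) * (deltaSq Pi Φ * dimen Pi / N)

/-- `Δ_p`, the nonnegative number with
`Δ_p ^ q = C · M · ∑ₘ δₘ ^ (-p) Dₘ ^ (-(p/2 - 1 - q))`; here `M` stands for `E ‖x₁ x₁ᵀ‖ ^ p`. -/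
def Delta {ι : Type*} [Fintype ι] {n : ℕ} (C p q M : ℝ) (Pi : ι → Matrix (Fin n) (Fin n) ℝ)
    (Φ : Matrix (Fin n × Fin n) (Fin n × Fin n) ℝ) : ℝ :=
  (C * M * ∑ m, √(deltaSq (Pi m) Φ) ^ (-p) * dimen (Pi m) ^ (-(p / 2 - 1 - q))) ^ (1 / q)

end CovSel

end

open CovSel

/-!
The oracle inequality holds with `K(θ) = 4 + 2 θ`, for a reason that uses little of the structure
of the penalty.

Write `S = (1/N) ∑ᵢ xᵢ xᵢᵀ`. Each `Πₘ` is an orthogonal projector, whatever the generalized inverse,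
so `Σ̂ₘ = Πₘ S Πₘ` (`isLeastSquares_eq_proj`). Minimality of the penalized contrast, compared with
the candidate `Πₘ Σ Πₘ`, and the triangle inequality give the pointwise bound
`‖Σ - Σ̃‖² ≤ 4 ‖Σ - Πₘ Σ Πₘ‖² + 2 (1 + θ) δₘ² Dₘ / N + 6 ‖S - Σ‖²` for every `m`
(`norm_sub_sq_le_of_isLeastSquares`). The rest is a bound for the moment of order `2 q` of the noise
`S - Σ`; no concentration inequality for the projected noise is needed.

With `M = E ‖x₁ x₁ᵀ‖ ^ p`, this moment is at most a constant times `(M ^ (2 / p) / N) ^ q`, in every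
dimension: as `p > 2 (1 + q)`, an even exponent lies between `2 q` and `p`, and the even moments of
a sum of independent centered vectors of a Hilbert space are controlled by induction
(`exists_integral_norm_sum_pow_le`, `exists_integral_norm_mean_sub_rpow_le`).

This is absorbed by the remainder `Δ_p δ_sup² / N`. Indeed `δₘ² Dₘ = Tr ((Πₘ ⊗ Πₘ) Φ)` is the total
variance of `Πₘ x₁ x₁ᵀ Πₘ`, hence at most `E ‖x₁ x₁ᵀ‖² ≤ M ^ (2 / p)`
(`trace_kronecker_mul_Phi_le`), and, since `Dₘ ≥ 1`, this forces the term of any single model in the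
sum that defines `Δ_p` to be large enough (`rpow_le_mul_penalty_term`, `mul_le_Delta_mul_iSup`).

For `q = 1` the infimum is rewritten by the bias–variance decomposition
`E ‖Σ - Σ̂ₘ‖² = ‖Σ - Πₘ Σ Πₘ‖² + δₘ² Dₘ / N` (`integral_norm_sub_proj_empMean_sq`).
-/

/-! ### Even moments of sums of independent centered vectors -/

/-- Expansion of `‖x + y‖ ^ (2 (k + 1))` to first order in `y`, written in terms of `a = ‖x‖`,
`b = ‖y‖`, `t = ⟪x, y⟫`. -/
lemma exists_abs_pow_sub_le (k : ℕ) : ∃ C : ℝ, 0 ≤ C ∧ ∀ a b t : ℝ, 0 ≤ a → 0 ≤ b → |t| ≤ a * b →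
    |(a ^ 2 + 2 * t + b ^ 2) ^ (k + 1) - a ^ (2 * (k + 1)) - 2 * (k + 1) * a ^ (2 * k) * t| ≤
      C * (b ^ 2 * (a + b) ^ (2 * k)) := by
  induction k with
  | zero =>
    refine ⟨1, zero_le_one, fun a b t _ _ _ => ?_⟩
    rw [show (a ^ 2 + 2 * t + b ^ 2) ^ (0 + 1) - a ^ (2 * (0 + 1)) -
      2 * ((0 : ℕ) + 1) * a ^ (2 * 0) * t = b ^ 2 by push_cast; ring, abs_of_nonneg (sq_nonneg b)]
    simp
  | succ k ih =>
    obtain ⟨C, hC, h⟩ := ih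
    refine ⟨C + (1 + 4 * (k + 1)), by positivity, fun a b t ha hb ht => ?_⟩
    have ht' := abs_le.mp ht
    set X := a ^ 2 + 2 * t + b ^ 2 with hX
    have hX0 : 0 ≤ X := by nlinarith [sq_nonneg (a - b)]
    have hX1 : X ≤ (a + b) ^ 2 := by nlinarith
    have hsplit : X ^ (k + 1 + 1) - a ^ (2 * (k + 1 + 1)) -
        2 * ((k + 1 : ℕ) + 1) * a ^ (2 * (k + 1)) * t =
        X * (X ^ (k + 1) - a ^ (2 * (k + 1)) - 2 * (k + 1) * a ^ (2 * k) * t) +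
          (a ^ (2 * (k + 1)) * b ^ 2 + 2 * (k + 1) * (a ^ (2 * k) * (t * (2 * t + b ^ 2)))) := by
      push_cast
      have : a ^ (2 * (k + 1 + 1)) = a ^ (2 * k) * a ^ 4 := by ring
      rw [this, show a ^ (2 * (k + 1)) = a ^ (2 * k) * a ^ 2 by ring, pow_succ X (k + 1), hX]
      ring
    have h1 : |X * (X ^ (k + 1) - a ^ (2 * (k + 1)) - 2 * (k + 1) * a ^ (2 * k) * t)| ≤
        C * (b ^ 2 * (a + b) ^ (2 * (k + 1))) := by
      rw [abs_mul, abs_of_nonneg hX0]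
      calc _ ≤ (a + b) ^ 2 * (C * (b ^ 2 * (a + b) ^ (2 * k))) :=
            mul_le_mul hX1 (h a b t ha hb ht) (abs_nonneg _) (by positivity)
        _ = _ := by ring
    have h2 : a ^ (2 * (k + 1)) * b ^ 2 ≤ b ^ 2 * (a + b) ^ (2 * (k + 1)) := by
      rw [mul_comm]; gcongr; linarith
    have h3 : |t * (2 * t + b ^ 2)| ≤ 2 * (b ^ 2 * (a + b) ^ 2) := by
      rw [abs_mul]
      have : |2 * t + b ^ 2| ≤ 2 * (a * b) + b ^ 2 := by
        rw [abs_le]; constructor <;> nlinarith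
      calc _ ≤ (a * b) * (2 * (a * b) + b ^ 2) :=
            mul_le_mul ht this (abs_nonneg _) (by positivity)
        _ ≤ _ := by
          have : 0 ≤ a * b ^ 3 := by positivity
          have : 0 ≤ b ^ 4 := by positivity
          nlinarith
    have h4 : |2 * (k + 1) * (a ^ (2 * k) * (t * (2 * t + b ^ 2)))| ≤
        4 * (k + 1) * (b ^ 2 * (a + b) ^ (2 * (k + 1))) := by
      rw [abs_mul, abs_mul (a ^ _), abs_of_nonneg (by positivity : (0 : ℝ) ≤ 2 * (k + 1)),
        abs_of_nonneg (by positivity : (0 : ℝ) ≤ a ^ (2 * k))]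
      have : a ^ (2 * k) ≤ (a + b) ^ (2 * k) := by gcongr; linarith
      calc _ ≤ 2 * ((k : ℝ) + 1) * ((a + b) ^ (2 * k) * (2 * (b ^ 2 * (a + b) ^ 2))) := by gcongr
        _ = _ := by ring
    rw [hsplit]
    refine (abs_add_le _ _).trans ?_
    have h5 := abs_add_le (a ^ (2 * (k + 1)) * b ^ 2)
      (2 * (k + 1) * (a ^ (2 * k) * (t * (2 * t + b ^ 2))))
    rw [abs_of_nonneg (by positivity : 0 ≤ a ^ (2 * (k + 1)) * b ^ 2)] at h5
    nlinarith

lemma exists_norm_add_pow_le (k : ℕ) : ∃ C : ℝ, 0 ≤ C ∧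
    ∀ {E : Type} [NormedAddCommGroup E] [InnerProductSpace ℝ E] (x y : E),
      ‖x + y‖ ^ (2 * (k + 1)) ≤ ‖x‖ ^ (2 * (k + 1)) + 2 * (k + 1) * (‖x‖ ^ (2 * k) * inner ℝ x y) +
        C * (‖x‖ ^ (2 * k) * ‖y‖ ^ 2 + ‖y‖ ^ (2 * (k + 1))) := by
  obtain ⟨C, hC, h⟩ := exists_abs_pow_sub_le k
  refine ⟨C * 2 ^ (2 * k - 1), by positivity, fun x y => ?_⟩
  have h1 := (abs_le.mp (h ‖x‖ ‖y‖ (inner ℝ x y) (norm_nonneg _) (norm_nonneg _)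
    (abs_real_inner_le_norm x y))).2
  rw [← norm_add_sq_real, ← pow_mul] at h1
  have h2 : ‖y‖ ^ 2 * (‖x‖ + ‖y‖) ^ (2 * k) ≤
      2 ^ (2 * k - 1) * (‖x‖ ^ (2 * k) * ‖y‖ ^ 2 + ‖y‖ ^ (2 * (k + 1))) := by
    calc _ ≤ ‖y‖ ^ 2 * (2 ^ (2 * k - 1) * (‖x‖ ^ (2 * k) + ‖y‖ ^ (2 * k))) := by
          gcongr; exact add_pow_le (norm_nonneg _) (norm_nonneg _) _
      _ = _ := by ring
  have h3 := mul_le_mul_of_nonneg_left h2 hC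
  linarith

/-- A dimension-free Marcinkiewicz–Zygmund (Rosenthal) inequality for even exponents: a sum of
`|s|` independent centered vectors has `2k`-th moment of order `(|s| B) ^ k`, where `B ^ j` bounds
the `2j`-th moment of each vector for all `j ≤ k`. The induction on `s`
peels off one summand: the first-order term has mean zero by independence, and the second-order one
is controlled by the `(2k - 2)`-th moment. -/
lemma exists_integral_norm_sum_pow_le (k : ℕ) : ∃ C : ℝ, 0 ≤ C ∧
    ∀ {Ω : Type*} [MeasurableSpace Ω] (P : Measure Ω) [IsProbabilityMeasure P]
      {E : Type} [NormedAddCommGroup E] [InnerProductSpace ℝ E] [CompleteSpace E]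
      [SecondCountableTopology E] [MeasurableSpace E] [BorelSpace E]
      {ι : Type} (X : ι → Ω → E) (B : ℝ), 0 ≤ B → (∀ i, Measurable (X i)) → iIndepFun X P →
      (∀ i, MemLp (X i) (2 * k : ℕ) P) → (∀ i, ∫ ω, X i ω ∂P = 0) →
      (∀ i, ∀ j ≤ k, ∫ ω, ‖X i ω‖ ^ (2 * j) ∂P ≤ B ^ j) →
      ∀ s : Finset ι, ∫ ω, ‖∑ i ∈ s, X i ω‖ ^ (2 * k) ∂P ≤ C * (s.card * B) ^ k := by
  classical
  induction k with
  | zero => exact ⟨1, zero_le_one, by intros; simp⟩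
  | succ k ih =>
    obtain ⟨C, hC, ih⟩ := ih
    obtain ⟨C', hC', hpow⟩ := exists_norm_add_pow_le k
    refine ⟨C' * (C + 1), by positivity, ?_⟩
    intro Ω _ P _ E _ _ _ _ _ _ ι X B hB hXm hXi hXL hX0 hXB s
    have hXL' : ∀ i, MemLp (X i) (2 * k : ℕ) P := fun i =>
      (hXL i).mono_exponent (by exact_mod_cast (by omega : 2 * k ≤ 2 * (k + 1)))
    have hX1 : ∀ i, Integrable (X i) P := fun i =>
      (hXL i).integrable (by exact_mod_cast (by omega : 1 ≤ 2 * (k + 1)))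
    have hX2 : ∀ i, MemLp (X i) (2 : ℕ) P := fun i =>
      (hXL i).mono_exponent (by exact_mod_cast (by omega : 2 ≤ 2 * (k + 1)))
    induction s using Finset.induction_on with
    | empty => simp
    | insert i s his hs =>
      set S : Ω → E := fun ω => ∑ j ∈ s, X j ω with hS
      have hSm : Measurable S := Finset.measurable_sum _ fun j _ => hXm j
      have hSL : MemLp S (2 * (k + 1) : ℕ) P := memLp_finsetSum _ fun j _ => hXL j
      have hSL' : MemLp S (2 * k : ℕ) P := memLp_finsetSum _ fun j _ => hXL' j
      have hind : S ⟂ᵢ[P] X i := by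
        convert hXi.indepFun_finsetSum_of_notMem hXm his
        ext ω
        simp [hS]
      have hSint : Integrable (fun ω => ‖S ω‖ ^ (2 * (k + 1))) P :=
        hSL.integrable_norm_pow (by omega)
      have hSint' : Integrable (fun ω => ‖S ω‖ ^ (2 * k)) P := by
        rcases Nat.eq_zero_or_pos k with rfl | hk
        · simp
        · exact hSL'.integrable_norm_pow (by omega)
      have hXint : Integrable (fun ω => ‖X i ω‖ ^ (2 * (k + 1))) P :=
        (hXL i).integrable_norm_pow (by omega)
      have hXint2 : Integrable (fun ω => ‖X i ω‖ ^ 2) P := (hX2 i).integrable_norm_pow (by omega)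
      -- the first-order term
      have hSvec : Integrable (fun ω => ‖S ω‖ ^ (2 * k) • S ω) P := by
        rw [← integrable_norm_iff (by fun_prop)]
        have : Integrable (fun ω => ‖S ω‖ ^ (2 * k + 1)) P :=
          (hSL.mono_exponent (p := (2 * k + 1 : ℕ))
            (by exact_mod_cast (by omega : 2 * k + 1 ≤ 2 * (k + 1)))).integrable_norm_pow (by omega)
        refine this.congr (ae_of_all _ fun ω => ?_)
        simp [norm_smul, pow_succ]
      have hindvec : (fun ω => ‖S ω‖ ^ (2 * k) • S ω) ⟂ᵢ[P] X i :=
        hind.comp (φ := fun x : E => ‖x‖ ^ (2 * k) • x) (ψ := id) (by fun_prop) measurable_id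
      have hcross : ∫ ω, ‖S ω‖ ^ (2 * k) * inner ℝ (S ω) (X i ω) ∂P = 0 := by
        have h : ∫ ω, inner ℝ (‖S ω‖ ^ (2 * k) • S ω) (X i ω) ∂P =
            inner ℝ (∫ ω, ‖S ω‖ ^ (2 * k) • S ω ∂P) (∫ ω, X i ω ∂P) :=
          hindvec.integral_bilin hSvec (hX1 i) (innerSL ℝ)
        simpa [hX0 i, inner_smul_left] using h
      have hcrossint : Integrable (fun ω => ‖S ω‖ ^ (2 * k) * inner ℝ (S ω) (X i ω)) P := by
        have h : Integrable (fun ω => inner ℝ (‖S ω‖ ^ (2 * k) • S ω) (X i ω)) P :=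
          hindvec.integrable_bilin hSvec (hX1 i) (innerSL ℝ)
        simpa [inner_smul_left] using h
      -- the second-order term
      have hindsq : (fun ω => ‖S ω‖ ^ (2 * k)) ⟂ᵢ[P] (fun ω => ‖X i ω‖ ^ 2) :=
        hind.comp (φ := fun x : E => ‖x‖ ^ (2 * k)) (ψ := fun x : E => ‖x‖ ^ 2)
          (by fun_prop) (by fun_prop)
      have hsq : ∫ ω, ‖S ω‖ ^ (2 * k) * ‖X i ω‖ ^ 2 ∂P =
          (∫ ω, ‖S ω‖ ^ (2 * k) ∂P) * ∫ ω, ‖X i ω‖ ^ 2 ∂P :=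
        hindsq.integral_fun_mul_eq_mul_integral hSint'.1 hXint2.1
      have hsqint : Integrable (fun ω => ‖S ω‖ ^ (2 * k) * ‖X i ω‖ ^ 2) P :=
        hindsq.integrable_mul hSint' hXint2
      have hlow := ih P X B hB hXm hXi hXL' hX0 (fun i j hj => hXB i j (by omega)) s
      have hB1 := hXB i 1 (by omega)
      have hBk := hXB i (k + 1) le_rfl
      simp only [mul_one, pow_one] at hB1
      have hint1 : Integrable (fun ω => ‖S ω‖ ^ (2 * (k + 1)) +
          2 * (k + 1) * (‖S ω‖ ^ (2 * k) * inner ℝ (S ω) (X i ω))) P :=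
        hSint.add (hcrossint.const_mul _)
      have hint2 : Integrable (fun ω =>
          C' * (‖S ω‖ ^ (2 * k) * ‖X i ω‖ ^ 2 + ‖X i ω‖ ^ (2 * (k + 1)))) P :=
        (hsqint.add hXint).const_mul _
      have hmain : ∫ ω, ‖∑ j ∈ insert i s, X j ω‖ ^ (2 * (k + 1)) ∂P ≤
          ∫ ω, ‖S ω‖ ^ (2 * (k + 1)) ∂P +
            C' * ((∫ ω, ‖S ω‖ ^ (2 * k) ∂P) * (∫ ω, ‖X i ω‖ ^ 2 ∂P) +
              ∫ ω, ‖X i ω‖ ^ (2 * (k + 1)) ∂P) := by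
        calc _ ≤ ∫ ω, (‖S ω‖ ^ (2 * (k + 1)) +
              2 * (k + 1) * (‖S ω‖ ^ (2 * k) * inner ℝ (S ω) (X i ω)) +
              C' * (‖S ω‖ ^ (2 * k) * ‖X i ω‖ ^ 2 + ‖X i ω‖ ^ (2 * (k + 1)))) ∂P := by
              refine integral_mono_of_nonneg (ae_of_all _ fun ω => by positivity)
                (hint1.add hint2)
                (ae_of_all _ fun ω => ?_)
              simp only [Finset.sum_insert his]
              rw [add_comm]
              exact hpow (S ω) (X i ω)
          _ = _ := by
              rw [integral_add hint1 hint2,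
                integral_add hSint (hcrossint.const_mul _), integral_const_mul, hcross,
                integral_const_mul, integral_add hsqint hXint, hsq]
              ring
      rw [Finset.card_insert_of_notMem his]
      set m : ℝ := (s.card : ℝ) with hm
      have hm0 : 0 ≤ m := Nat.cast_nonneg _
      have h1 : (∫ ω, ‖S ω‖ ^ (2 * k) ∂P) * (∫ ω, ‖X i ω‖ ^ 2 ∂P) ≤ C * (m * B) ^ k * B :=
        mul_le_mul hlow hB1 (integral_nonneg fun ω => by positivity) (by positivity)
      have h2 : m ^ k ≤ (m + 1) ^ k := by gcongr; linarith
      have h3 : 1 ≤ (m + 1) ^ k := one_le_pow₀ (by linarith)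
      have h4 : m ^ (k + 1) ≤ (m + 1) ^ k * m := by rw [pow_succ]; gcongr
      calc _ ≤ C' * (C + 1) * (m * B) ^ (k + 1) + C' * (C * (m * B) ^ k * B + B ^ (k + 1)) := by
            refine hmain.trans ?_
            gcongr
        _ = C' * B ^ (k + 1) * ((C + 1) * m ^ (k + 1) + (C * m ^ k + 1)) := by
            rw [mul_pow, mul_pow]; ring
        _ ≤ C' * B ^ (k + 1) * ((C + 1) * ((m + 1) ^ k * m) +
              (C * (m + 1) ^ k + (m + 1) ^ k)) := by gcongr
        _ = _ := by push_cast; rw [mul_pow, pow_succ (m + 1)]; ring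

/-! ### Moments of the error of an empirical mean -/

lemma integrable_norm_rpow_of_memLp {Ω : Type*} [MeasurableSpace Ω] {P : Measure Ω}
    {E : Type*} [NormedAddCommGroup E] {f : Ω → E} {p : ℝ} (hp : 0 < p)
    (hf : MemLp f (ENNReal.ofReal p) P) : Integrable (fun ω => ‖f ω‖ ^ p) P := by
  simpa [ENNReal.toReal_ofReal hp.le] using
    hf.integrable_norm_rpow (ENNReal.ofReal_pos.mpr hp).ne' ENNReal.ofReal_ne_top

/-- Lyapunov's inequality. -/
lemma integral_norm_rpow_le {Ω : Type*} [MeasurableSpace Ω] {P : Measure Ω}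
    [IsProbabilityMeasure P] {E : Type*} [NormedAddCommGroup E] {f : Ω → E} {r p : ℝ}
    (hr : 0 < r) (hrp : r ≤ p) (hf : MemLp f (ENNReal.ofReal p) P) :
    ∫ ω, ‖f ω‖ ^ r ∂P ≤ (∫ ω, ‖f ω‖ ^ p ∂P) ^ (r / p) := by
  have hp : 0 < p := hr.trans_le hrp
  have hle : ENNReal.ofReal r ≤ ENNReal.ofReal p := ENNReal.ofReal_le_ofReal hrp
  have h := ENNReal.toReal_mono hf.2.ne (eLpNorm_le_eLpNorm_of_exponent_le hle hf.1)
  rw [toReal_eLpNorm hf.1, toReal_eLpNorm hf.1,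
    lpNorm_eq_integral_norm_rpow_toReal (ENNReal.ofReal_pos.mpr hr).ne' ENNReal.ofReal_ne_top hf.1,
    lpNorm_eq_integral_norm_rpow_toReal (ENNReal.ofReal_pos.mpr hp).ne' ENNReal.ofReal_ne_top hf.1,
    ENNReal.toReal_ofReal hr.le, ENNReal.toReal_ofReal hp.le] at h
  have h0 : 0 ≤ ∫ ω, ‖f ω‖ ^ r ∂P := integral_nonneg fun ω => by positivity
  have h1 : 0 ≤ ∫ ω, ‖f ω‖ ^ p ∂P := integral_nonneg fun ω => by positivity
  calc ∫ ω, ‖f ω‖ ^ r ∂P = ((∫ ω, ‖f ω‖ ^ r ∂P) ^ r⁻¹) ^ r := (Real.rpow_inv_rpow h0 hr.ne').symm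
    _ ≤ ((∫ ω, ‖f ω‖ ^ p ∂P) ^ p⁻¹) ^ r := by gcongr
    _ = _ := by rw [← Real.rpow_mul h1]; congr 1; field_simp

/-- The empirical mean of `N` independent vectors with mean `f` and `p`-th moment at most `M`, for
some `p > 2 (1 + q)`, satisfies `E ‖mean - f‖ ^ (2 q) ≤ C (M ^ (2 / p) / N) ^ q`, with a constant
that depends only on `q`. There is an even integer between `2 q` and `2 (1 + q)`, so the
inequality for even exponents and two applications of Lyapunov's inequality suffice. -/
lemma exists_integral_norm_mean_sub_rpow_le {q p : ℝ} (hq : 0 < q) (hp : 2 * (1 + q) < p) :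
    ∃ C : ℝ, 0 < C ∧
    ∀ {Ω : Type*} [MeasurableSpace Ω] (P : Measure Ω) [IsProbabilityMeasure P]
      {E : Type} [NormedAddCommGroup E] [InnerProductSpace ℝ E] [CompleteSpace E]
      [SecondCountableTopology E] [MeasurableSpace E] [BorelSpace E]
      {N : ℕ} [NeZero N] (Y : Fin N → Ω → E) (f : E) (M : ℝ),
      (∀ i, Measurable (Y i)) → iIndepFun Y P →
      (∀ i, MemLp (Y i) (ENNReal.ofReal p) P) → (∀ i, ∫ ω, Y i ω ∂P = f) →
      (∀ i, ∫ ω, ‖Y i ω‖ ^ p ∂P ≤ M) →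
      ∫ ω, ‖(1 / (N : ℝ)) • ∑ i, Y i ω - f‖ ^ (2 * q) ∂P ≤ C * (M ^ (2 / p) / N) ^ q := by
  set k := ⌈q⌉₊ with hk
  have hk0 : 0 < k := Nat.ceil_pos.mpr hq
  have hk0' : (0 : ℝ) < k := by exact_mod_cast hk0
  have hqk : q ≤ k := Nat.le_ceil q
  have hkp : 2 * (k : ℝ) < p := by linarith [Nat.ceil_lt_add_one hq.le]
  have hp0 : 0 < p := by linarith
  obtain ⟨C, hC, hmom⟩ := exists_integral_norm_sum_pow_le k
  refine ⟨(C + 1) ^ (q / k) * 4 ^ q, by positivity, ?_⟩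
  intro Ω _ P _ E _ _ _ _ _ _ N _ Y f M hYm hYi hYL hYf hYM
  have hN : (0 : ℝ) < N := by exact_mod_cast Nat.pos_of_ne_zero (NeZero.ne N)
  have hM : 0 ≤ M := (integral_nonneg fun ω => by positivity).trans (hYM 0)
  -- moments of `Y i` of lower order
  have hYlow : ∀ i, ∀ r : ℝ, 0 < r → r ≤ p → ∫ ω, ‖Y i ω‖ ^ r ∂P ≤ M ^ (r / p) := fun i r hr hrp =>
    (integral_norm_rpow_le hr hrp (hYL i)).trans (Real.rpow_le_rpow
      (integral_nonneg fun ω => by positivity) (hYM i) (by positivity))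
  have hf : ‖f‖ ≤ M ^ (1 / p) := by
    rw [← hYf 0]
    refine (norm_integral_le_integral_norm _).trans ?_
    simpa using hYlow 0 1 one_pos (by linarith)
  -- centering at most doubles the norm in `L ^ p`, whence the factor `4 = 2 ^ 2`
  set B : ℝ := 4 * M ^ (2 / p) with hB
  set X : Fin N → Ω → E := fun i ω => Y i ω - f with hX
  have hXm : ∀ i, Measurable (X i) := fun i => (hYm i).sub_const f
  have hXi : iIndepFun X P := hYi.comp (fun _ x => x - f) fun _ => measurable_id.sub_const f
  have hYL' : ∀ i, ∀ j ≤ k, MemLp (Y i) (2 * j : ℕ) P := fun i j hj =>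
    (hYL i).mono_exponent (by
      rw [← ENNReal.ofReal_natCast]
      refine ENNReal.ofReal_le_ofReal ?_
      have : (j : ℝ) ≤ k := by exact_mod_cast hj
      push_cast
      linarith)
  have hXL : ∀ i, MemLp (X i) (2 * k : ℕ) P := fun i => (hYL' i k le_rfl).sub (memLp_const f)
  have hYint : ∀ i, Integrable (Y i) P := fun i =>
    (hYL' i k le_rfl).integrable (by exact_mod_cast (by omega : 1 ≤ 2 * k))
  have hX0 : ∀ i, ∫ ω, X i ω ∂P = 0 := fun i => by
    simp only [hX]
    rw [integral_sub (hYint i) (integrable_const f), hYf i]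
    simp
  have hXB : ∀ i, ∀ j ≤ k, ∫ ω, ‖X i ω‖ ^ (2 * j) ∂P ≤ B ^ j := by
    intro i j hj
    rcases Nat.eq_zero_or_pos j with rfl | hj0
    · simp
    have hjk : (j : ℝ) ≤ k := by exact_mod_cast hj
    have hj0' : (0 : ℝ) < j := by exact_mod_cast hj0
    have hI : Integrable (fun ω => ‖Y i ω‖ ^ (2 * j)) P :=
      (hYL' i j hj).integrable_norm_pow (by omega)
    have h1 : ∫ ω, ‖Y i ω‖ ^ (2 * j) ∂P ≤ (M ^ (2 / p)) ^ j := by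
      have := hYlow i (2 * j : ℕ) (by push_cast; positivity) (by push_cast; linarith)
      simp only [Real.rpow_natCast] at this
      refine this.trans_eq ?_
      rw [← Real.rpow_natCast, ← Real.rpow_mul hM]
      congr 1
      push_cast
      ring
    have h2 : ‖f‖ ^ (2 * j) ≤ (M ^ (2 / p)) ^ j := by
      calc ‖f‖ ^ (2 * j) ≤ (M ^ (1 / p)) ^ (2 * j) := by gcongr
        _ = _ := by
          rw [pow_mul, ← Real.rpow_natCast (M ^ (1 / p)), ← Real.rpow_mul hM]
          congr 2
          push_cast
          ring
    calc ∫ ω, ‖X i ω‖ ^ (2 * j) ∂P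
        ≤ ∫ ω, 2 ^ (2 * j - 1) * (‖Y i ω‖ ^ (2 * j) + ‖f‖ ^ (2 * j)) ∂P := by
          refine integral_mono_of_nonneg (ae_of_all _ fun ω => by positivity)
            ((hI.add (integrable_const _)).const_mul _) (ae_of_all _ fun ω => ?_)
          exact (pow_le_pow_left₀ (norm_nonneg _) (norm_sub_le _ _) _).trans
            (add_pow_le (norm_nonneg _) (norm_nonneg _) _)
      _ = 2 ^ (2 * j - 1) * (∫ ω, ‖Y i ω‖ ^ (2 * j) ∂P + ‖f‖ ^ (2 * j)) := by
          rw [integral_const_mul, integral_add hI (integrable_const _)]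
          simp
      _ ≤ 2 ^ (2 * j - 1) * ((M ^ (2 / p)) ^ j + (M ^ (2 / p)) ^ j) := by gcongr
      _ = 2 ^ (2 * j - 1 + 1) * (M ^ (2 / p)) ^ j := by ring
      _ = B ^ j := by
          rw [show 2 * j - 1 + 1 = 2 * j by omega, pow_mul, hB, mul_pow]
          norm_num
  have hsum := hmom P X B (by positivity) hXm hXi hXL hX0 hXB Finset.univ
  -- the error is the mean of the `X i`
  set e : Ω → E := fun ω => (1 / (N : ℝ)) • ∑ i, Y i ω - f with he
  have heX : ∀ ω, e ω = (1 / (N : ℝ)) • ∑ i, X i ω := fun ω => by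
    simp only [he, hX, Finset.sum_sub_distrib, smul_sub, Finset.sum_const, Finset.card_univ,
      Fintype.card_fin]
    rw [← Nat.cast_smul_eq_nsmul ℝ, smul_smul, one_div_mul_cancel hN.ne', one_smul]
  have heL : MemLp e (ENNReal.ofReal (2 * k)) P := by
    have : MemLp (fun ω => (1 / (N : ℝ)) • ∑ i, X i ω) (2 * k : ℕ) P :=
      (memLp_finsetSum _ fun i _ => hXL i).const_smul _
    rw [funext heX]
    convert this
    rw [← ENNReal.ofReal_natCast]
    push_cast
    rfl
  have hek : ∫ ω, ‖e ω‖ ^ (2 * k : ℝ) ∂P ≤ C * (B / N) ^ k := by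
    have h1 : ∀ ω, ‖e ω‖ ^ (2 * k : ℝ) = (1 / (N : ℝ)) ^ (2 * k) * ‖∑ i, X i ω‖ ^ (2 * k) := by
      intro ω
      rw [show (2 * k : ℝ) = ((2 * k : ℕ) : ℝ) by push_cast; rfl, Real.rpow_natCast, heX, norm_smul,
        mul_pow, Real.norm_of_nonneg (by positivity)]
    simp_rw [h1]
    rw [integral_const_mul]
    calc _ ≤ (1 / (N : ℝ)) ^ (2 * k) * (C * ((Finset.univ : Finset (Fin N)).card * B) ^ k) := by
          gcongr
      _ = _ := by
          rw [Finset.card_univ, Fintype.card_fin, pow_mul, mul_left_comm, ← mul_pow]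
          congr 2
          field_simp
  calc ∫ ω, ‖e ω‖ ^ (2 * q) ∂P ≤ (∫ ω, ‖e ω‖ ^ (2 * k : ℝ) ∂P) ^ (2 * q / (2 * k)) :=
        integral_norm_rpow_le (by positivity) (by linarith) heL
    _ ≤ ((C + 1) * (B / N) ^ k) ^ (q / k) := by
        rw [mul_div_mul_left _ _ two_ne_zero]
        refine Real.rpow_le_rpow (integral_nonneg fun ω => by positivity) (hek.trans ?_)
          (by positivity)
        have : 0 ≤ (B / N) ^ k := by positivity
        nlinarith
    _ = (C + 1) ^ (q / k) * 4 ^ q * (M ^ (2 / p) / N) ^ q := by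
        have h4 : B / N = 4 * (M ^ (2 / p) / N) := by rw [hB]; ring
        rw [Real.mul_rpow (by positivity) (by positivity), ← Real.rpow_natCast,
          ← Real.rpow_mul (by positivity), mul_div_cancel₀ _ hk0'.ne', h4,
          Real.mul_rpow (by norm_num) (by positivity)]
        ring

/-! ### Frobenius geometry and least squares -/

/-- `vec` as a linear map into the Euclidean space, where it is isometric for the Frobenius norm. -/
def euclVec (n : ℕ) : Matrix (Fin n) (Fin n) ℝ →ₗ[ℝ] EuclideanSpace ℝ (Fin n × Fin n) where
  toFun A := WithLp.toLp 2 (Matrix.vec A)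
  map_add' _ _ := rfl
  map_smul' _ _ := rfl

lemma euclVec_apply {n : ℕ} (A : Matrix (Fin n) (Fin n) ℝ) (a : Fin n × Fin n) :
    euclVec n A a = A a.2 a.1 := rfl

lemma norm_sq_eq_sum {n : ℕ} (A : Matrix (Fin n) (Fin n) ℝ) :
    ‖A‖ ^ 2 = ∑ a, Matrix.vec A a ^ 2 := by
  have h0 : 0 ≤ ∑ i, ∑ j, ‖A i j‖ ^ (2 : ℝ) := by positivity
  rw [Matrix.frobenius_norm_def, ← Real.rpow_natCast, ← Real.rpow_mul h0]
  norm_num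
  rw [Finset.sum_comm, ← Finset.univ_product_univ, Finset.sum_product]

lemma norm_euclVec {n : ℕ} (A : Matrix (Fin n) (Fin n) ℝ) : ‖euclVec n A‖ = ‖A‖ := by
  rw [← sq_eq_sq₀ (norm_nonneg _) (norm_nonneg _), norm_sq_eq_sum, EuclideanSpace.norm_sq_eq]
  simp [euclVec_apply, Matrix.vec]

lemma inner_euclVec {n : ℕ} (A B : Matrix (Fin n) (Fin n) ℝ) :
    inner ℝ (euclVec n A) (euclVec n B) = (Aᵀ * B).trace := by
  simp only [PiLp.inner_apply, euclVec_apply, RCLike.inner_apply, conj_trivial, Matrix.trace,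
    Matrix.diag, Matrix.mul_apply, Matrix.transpose_apply, ← Finset.univ_product_univ,
    Finset.sum_product]
  simp_rw [mul_comm]

lemma proj_mul_self_left {n k : ℕ} {G : Matrix (Fin n) (Fin k) ℝ} {H : Matrix (Fin k) (Fin k) ℝ}
    (hH : IsGenInv (Gᵀ * G) H) : proj G H * G = G := by
  have hH' : Gᵀ * (G * H * Gᵀ * G) = Gᵀ * G := by
    simpa only [IsGenInv, Matrix.mul_assoc] using hH
  have h : (G * H * Gᵀ * G - G)ᵀ * (G * H * Gᵀ * G - G) = 0 := by
    have h1 : Gᵀ * (G * H * Gᵀ * G - G) = 0 := by rw [Matrix.mul_sub, hH', sub_self]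
    have h2 : (G * H * Gᵀ * G - G)ᵀ = (Gᵀ * G * Hᵀ - 1) * Gᵀ := by
      simp [Matrix.transpose_mul, Matrix.sub_mul, Matrix.mul_assoc]
    rw [h2, Matrix.mul_assoc, h1, Matrix.mul_zero]
  rw [← Matrix.conjTranspose_eq_transpose_of_trivial, Matrix.conjTranspose_mul_self_eq_zero] at h
  exact sub_eq_zero.mp h

lemma proj_mul_transpose {n k : ℕ} {G : Matrix (Fin n) (Fin k) ℝ} {H : Matrix (Fin k) (Fin k) ℝ}
    (hH : IsGenInv (Gᵀ * G) H) : proj G H * (proj G H)ᵀ = proj G H := by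
  have h : Gᵀ * (proj G H)ᵀ = Gᵀ := by
    rw [← Matrix.transpose_mul, proj_mul_self_left hH]
  nth_rewrite 1 [proj]
  rw [Matrix.mul_assoc, h, proj]

/-- `G (Gᵀ G)⁻ Gᵀ` is symmetric for every choice of the generalized inverse, even one that is not
symmetric itself. -/
lemma proj_isSymm {n k : ℕ} {G : Matrix (Fin n) (Fin k) ℝ} {H : Matrix (Fin k) (Fin k) ℝ}
    (hH : IsGenInv (Gᵀ * G) H) : (proj G H)ᵀ = proj G H := by
  conv_lhs => rw [← proj_mul_transpose hH]
  rw [Matrix.transpose_mul, Matrix.transpose_transpose, proj_mul_transpose hH]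

lemma proj_idem {n k : ℕ} {G : Matrix (Fin n) (Fin k) ℝ} {H : Matrix (Fin k) (Fin k) ℝ}
    (hH : IsGenInv (Gᵀ * G) H) : proj G H * proj G H = proj G H := by
  conv_lhs => rw [← proj_isSymm hH]
  rw [proj_isSymm hH]
  nth_rewrite 2 [← proj_isSymm hH]
  exact proj_mul_transpose hH

lemma proj_mul_mul_proj_of_mem {n k : ℕ} {G : Matrix (Fin n) (Fin k) ℝ}
    {H : Matrix (Fin k) (Fin k) ℝ} (hH : IsGenInv (Gᵀ * G) H) {Γ : Matrix (Fin n) (Fin n) ℝ}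
    (hΓ : Γ ∈ modelSet G) : proj G H * Γ * proj G H = Γ := by
  obtain ⟨Ψ, -, rfl⟩ := hΓ
  have h : Gᵀ * proj G H = Gᵀ := by
    rw [← proj_isSymm hH, ← Matrix.transpose_mul, proj_mul_self_left hH]
  rw [Matrix.mul_assoc, Matrix.mul_assoc (G * Ψ), h, ← Matrix.mul_assoc, ← Matrix.mul_assoc,
    proj_mul_self_left hH]

lemma proj_mul_mul_proj_mem {n k : ℕ} {G : Matrix (Fin n) (Fin k) ℝ}
    {H : Matrix (Fin k) (Fin k) ℝ} (hH : IsGenInv (Gᵀ * G) H) {A : Matrix (Fin n) (Fin n) ℝ}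
    (hA : A.IsSymm) : proj G H * A * proj G H ∈ modelSet G := by
  refine ⟨H * Gᵀ * A * G * Hᵀ, ?_, ?_⟩
  · simp only [Matrix.IsSymm, Matrix.transpose_mul, Matrix.transpose_transpose, hA.eq,
      Matrix.mul_assoc]
  · nth_rewrite 2 [← proj_isSymm hH]
    simp only [proj, Matrix.transpose_mul, Matrix.transpose_transpose, Matrix.mul_assoc]

/-- Pythagoras' theorem for the orthogonal projection `A ↦ Π A Π`. -/
lemma norm_sub_sq_of_proj {n : ℕ} {Q : Matrix (Fin n) (Fin n) ℝ} (hQ : Qᵀ = Q) (hQQ : Q * Q = Q)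
    (A : Matrix (Fin n) (Fin n) ℝ) {Γ : Matrix (Fin n) (Fin n) ℝ} (hΓ : Q * Γ * Q = Γ) :
    ‖A - Γ‖ ^ 2 = ‖A - Q * A * Q‖ ^ 2 + ‖Q * A * Q - Γ‖ ^ 2 := by
  have hW : Q * (Q * A * Q - Γ) * Q = Q * A * Q - Γ := by
    rw [Matrix.mul_sub, Matrix.sub_mul, hΓ]
    congr 1
    rw [← Matrix.mul_assoc, ← Matrix.mul_assoc, hQQ, Matrix.mul_assoc, hQQ]
  set W := Q * A * Q - Γ with hWdef
  have hinner : inner ℝ (euclVec n (A - Q * A * Q)) (euclVec n W) = 0 := by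
    rw [inner_euclVec, Matrix.transpose_sub, Matrix.sub_mul, Matrix.trace_sub, sub_eq_zero]
    nth_rewrite 1 [← hW]
    simp only [Matrix.transpose_mul, hQ]
    rw [Matrix.trace_mul_comm, ← Matrix.trace_mul_comm W, Matrix.mul_assoc (Q * W),
      Matrix.mul_assoc Q, Matrix.trace_mul_comm Q]
    simp only [Matrix.mul_assoc]
  rw [show A - Γ = (A - Q * A * Q) + W by rw [hWdef]; abel, ← norm_euclVec, map_add,
    norm_add_sq_real, hinner, norm_euclVec, norm_euclVec]
  ring

lemma norm_proj_mul_mul_proj_sq_le {n : ℕ} {Q : Matrix (Fin n) (Fin n) ℝ} (hQ : Qᵀ = Q)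
    (hQQ : Q * Q = Q) (A : Matrix (Fin n) (Fin n) ℝ) : ‖Q * A * Q‖ ^ 2 ≤ ‖A‖ ^ 2 := by
  have h := norm_sub_sq_of_proj hQ hQQ A (Γ := 0) (by simp)
  simp only [sub_zero] at h
  nlinarith [sq_nonneg ‖A - Q * A * Q‖]

/-- The empirical second-moment matrix `S = (1/N) ∑ᵢ xᵢ xᵢᵀ`. -/
noncomputable def empMean {n N : ℕ} (x : Fin N → Fin n → ℝ) : Matrix (Fin n) (Fin n) ℝ :=
  (1 / (N : ℝ)) • ∑ i, outer (x i)

lemma outer_isSymm {n : ℕ} (v : Fin n → ℝ) : (outer v).IsSymm := by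
  ext i j
  simp [outer, Matrix.vecMulVec_apply, mul_comm]

lemma empMean_isSymm {n N : ℕ} (x : Fin N → Fin n → ℝ) : (empMean x).IsSymm := by
  simp only [Matrix.IsSymm, empMean, Matrix.transpose_smul, Matrix.transpose_sum,
    (outer_isSymm _).eq]

/-- Up to a term that does not depend on `Γ`, the contrast is the squared distance from `Γ` to the
empirical second-moment matrix. -/
lemma contrast_eq {n N : ℕ} [NeZero N] (x : Fin N → Fin n → ℝ) (Γ : Matrix (Fin n) (Fin n) ℝ) :
    contrast x Γ = contrast x (empMean x) + ‖empMean x - Γ‖ ^ 2 := by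
  have hN : (N : ℝ) ≠ 0 := by exact_mod_cast NeZero.ne N
  set S := empMean x with hS
  have hterm : ∀ i, ‖outer (x i) - Γ‖ ^ 2 = ‖outer (x i) - S‖ ^ 2 +
      2 * inner ℝ (euclVec n (outer (x i) - S)) (euclVec n (S - Γ)) + ‖S - Γ‖ ^ 2 := fun i => by
    rw [← norm_euclVec (outer (x i) - S), ← norm_euclVec (S - Γ), ← norm_add_sq_real, ← map_add,
      norm_euclVec]
    congr 2
    abel
  have hsum : ∑ i, (outer (x i) - S) = 0 := by
    rw [Finset.sum_sub_distrib, Finset.sum_const, Finset.card_univ, Fintype.card_fin,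
      ← Nat.cast_smul_eq_nsmul ℝ, hS, empMean, smul_smul, mul_one_div_cancel hN, one_smul, sub_self]
  simp only [contrast, hterm, Finset.sum_add_distrib, ← Finset.mul_sum, ← sum_inner, ← map_sum,
    hsum, map_zero, inner_zero_left, Finset.sum_const, Finset.card_univ, Fintype.card_fin,
    nsmul_eq_mul]
  field_simp
  ring

/-- The least squares covariance estimator is `Π S Π`. -/
lemma isLeastSquares_eq_proj {n N k : ℕ} [NeZero N] {G : Matrix (Fin n) (Fin k) ℝ}
    {H : Matrix (Fin k) (Fin k) ℝ} (hH : IsGenInv (Gᵀ * G) H) {x : Fin N → Fin n → ℝ}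
    {Γ : Matrix (Fin n) (Fin n) ℝ} (hΓ : IsLeastSquares G x Γ) :
    Γ = proj G H * empMean x * proj G H := by
  have h := hΓ.2 _ (proj_mul_mul_proj_mem hH (empMean_isSymm x))
  rw [contrast_eq, contrast_eq x (_ * _),
    norm_sub_sq_of_proj (proj_isSymm hH) (proj_idem hH) _ (proj_mul_mul_proj_of_mem hH hΓ.1)] at h
  have h0 : ‖proj G H * empMean x * proj G H - Γ‖ = 0 := by
    have := sq_nonneg ‖proj G H * empMean x * proj G H - Γ‖
    exact pow_eq_zero_iff two_ne_zero |>.mp (by linarith)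
  exact (sub_eq_zero.mp (norm_eq_zero.mp h0)).symm

/-- A deterministic oracle inequality for penalized least squares: minimality of the penalized
contrast is compared with the candidate `Π A Π` in the model `m`, and the triangle inequality
turns distances to the empirical mean into distances to `A`. -/
lemma norm_sub_sq_le_of_isLeastSquares {n N k : ℕ} [NeZero N]
    {G : Matrix (Fin n) (Fin k) ℝ} {H : Matrix (Fin k) (Fin k) ℝ} (hH : IsGenInv (Gᵀ * G) H)
    {x : Fin N → Fin n → ℝ} {Γ : Matrix (Fin n) (Fin n) ℝ} (hΓ : IsLeastSquares G x Γ)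
    {A : Matrix (Fin n) (Fin n) ℝ} (hA : A.IsSymm)
    {Γ' : Matrix (Fin n) (Fin n) ℝ} {a b : ℝ} (hb : 0 ≤ b)
    (hΓ' : contrast x Γ' + b ≤ contrast x Γ + a) :
    ‖A - Γ'‖ ^ 2 ≤ 4 * ‖A - proj G H * A * proj G H‖ ^ 2 + 2 * a + 6 * ‖empMean x - A‖ ^ 2 := by
  have h := hΓ.2 _ (proj_mul_mul_proj_mem hH hA)
  set S := empMean x
  have h1 : contrast x Γ' + b ≤ contrast x (proj G H * A * proj G H) + a := by linarith
  rw [contrast_eq, contrast_eq x (_ * _)] at h1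
  have t1 : ‖A - Γ'‖ ≤ ‖S - A‖ + ‖S - Γ'‖ := by
    rw [norm_sub_rev S A]; exact norm_sub_le_norm_sub_add_norm_sub A S Γ'
  have t2 : ‖S - proj G H * A * proj G H‖ ≤ ‖S - A‖ + ‖A - proj G H * A * proj G H‖ :=
    norm_sub_le_norm_sub_add_norm_sub _ _ _
  have s1 : ‖A - Γ'‖ ^ 2 ≤ 2 * ‖S - A‖ ^ 2 + 2 * ‖S - Γ'‖ ^ 2 := by
    have := pow_le_pow_left₀ (norm_nonneg _) t1 2
    nlinarith [sq_nonneg (‖S - A‖ - ‖S - Γ'‖)]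
  have s2 : ‖S - proj G H * A * proj G H‖ ^ 2 ≤
      2 * ‖S - A‖ ^ 2 + 2 * ‖A - proj G H * A * proj G H‖ ^ 2 := by
    have := pow_le_pow_left₀ (norm_nonneg _) t2 2
    nlinarith [sq_nonneg (‖S - A‖ - ‖A - proj G H * A * proj G H‖)]
  linarith

/-! ### Variance of the projected observations -/

lemma sum_variance_mulVec {Ω κ : Type*} [MeasurableSpace Ω] {P : Measure Ω}
    [IsProbabilityMeasure P] [Fintype κ] {z : Ω → κ → ℝ}
    (hz : ∀ a, MemLp (fun ω => z ω a) 2 P) (A : Matrix κ κ ℝ) :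
    ∑ a, Var[fun ω => (A *ᵥ z ω) a; P] = (Aᵀ * A * covMat P z).trace := by
  have hvar : ∀ a, Var[fun ω => (A *ᵥ z ω) a; P] = (A * covMat P z * Aᵀ) a a := by
    intro a
    have hm : ∀ b, MemLp (fun ω => A a b * z ω b) 2 P := fun b => (hz b).const_mul _
    simp only [Matrix.mulVec, dotProduct]
    rw [variance_fun_sum hm]
    simp only [covariance_const_mul_left, covariance_const_mul_right, Matrix.mul_apply,
      Matrix.transpose_apply, Finset.sum_mul, covMat, Matrix.of_apply]
    rw [Finset.sum_comm]
    refine Finset.sum_congr rfl fun b _ => Finset.sum_congr rfl fun c _ => by ring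
  simp only [hvar]
  change (A * covMat P z * Aᵀ).trace = _
  rw [Matrix.trace_mul_comm, Matrix.mul_assoc]

/-- The bias–variance decomposition for the mean of `N` i.i.d. real variables. -/
lemma integral_sub_mean_sq {Ω : Type*} [MeasurableSpace Ω] {P : Measure Ω}
    [IsProbabilityMeasure P] {N : ℕ} [NeZero N] {U : Fin N → Ω → ℝ}
    (hU : ∀ i, MemLp (U i) 2 P) (hind : iIndepFun U P) (hid : ∀ i, IdentDistrib (U i) (U 0) P P)
    (c : ℝ) :
    Integrable (fun ω => (c - (1 / (N : ℝ)) * ∑ i, U i ω) ^ 2) P ∧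
    ∫ ω, (c - (1 / (N : ℝ)) * ∑ i, U i ω) ^ 2 ∂P =
      (c - ∫ ω, U 0 ω ∂P) ^ 2 + Var[U 0; P] / N := by
  have hN : (N : ℝ) ≠ 0 := by exact_mod_cast NeZero.ne N
  set V : Ω → ℝ := fun ω => c - (1 / (N : ℝ)) * ∑ i, U i ω with hV
  have hsum : MemLp (fun ω => ∑ i, U i ω) 2 P := memLp_finsetSum _ fun i _ => hU i
  have hmean : MemLp (fun ω => (1 / (N : ℝ)) * ∑ i, U i ω) 2 P := hsum.const_mul _
  have hVL : MemLp V 2 P := (memLp_const c).sub hmean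
  refine ⟨hVL.integrable_sq, ?_⟩
  have hint : ∫ ω, V ω ∂P = c - ∫ ω, U 0 ω ∂P := by
    rw [hV, integral_sub (integrable_const c) (hmean.integrable one_le_two), integral_const_mul,
      integral_finsetSum _ fun i _ => (hU i).integrable one_le_two]
    simp only [(hid _).integral_eq, integral_const, probReal_univ, one_smul, Finset.sum_const,
      Finset.card_univ, Fintype.card_fin, nsmul_eq_mul]
    field_simp
  have hvar : Var[V; P] = Var[U 0; P] / N := by
    rw [hV, variance_const_sub hmean.1, variance_const_mul]
    have := IndepFun.variance_sum (s := Finset.univ) (fun i _ => hU i)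
      (fun i _ j _ hij => hind.indepFun hij)
    have h2 : (fun ω => ∑ i, U i ω) = ∑ i, U i := by ext ω; simp
    rw [h2, this]
    simp only [(hid _).variance_eq, Finset.sum_const, Finset.card_univ, Fintype.card_fin,
      nsmul_eq_mul]
    field_simp
  have h := variance_eq_sub hVL
  rw [hvar, hint] at h
  have h3 : ∫ ω, V ω ^ 2 ∂P = P[V ^ 2] := rfl
  rw [h3]
  linarith

/-! ### Passing from pointwise bounds to moments -/

lemma add_rpow_le_two_rpow_mul {a b q : ℝ} (ha : 0 ≤ a) (hb : 0 ≤ b) (hq : 0 ≤ q) :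
    (a + b) ^ q ≤ 2 ^ q * (a ^ q + b ^ q) := by
  have ha' : 0 ≤ a ^ q := by positivity
  have hb' : 0 ≤ b ^ q := by positivity
  have h2 : (0 : ℝ) ≤ 2 ^ q := by positivity
  rcases le_total a b with h | h
  · calc (a + b) ^ q ≤ (2 * b) ^ q := by gcongr; linarith
      _ = 2 ^ q * b ^ q := Real.mul_rpow (by norm_num) hb
      _ ≤ _ := by gcongr; linarith
  · calc (a + b) ^ q ≤ (2 * a) ^ q := by gcongr; linarith
      _ = 2 ^ q * a ^ q := Real.mul_rpow (by norm_num) ha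
      _ ≤ _ := by gcongr; linarith

lemma add_rpow_le_two_rpow_sub_one_mul {a b r : ℝ} (ha : 0 ≤ a) (hb : 0 ≤ b) (hr : 1 ≤ r) :
    (a + b) ^ r ≤ 2 ^ (r - 1) * (a ^ r + b ^ r) := by
  lift a to NNReal using ha
  lift b to NNReal using hb
  exact_mod_cast NNReal.rpow_add_le_mul_rpow_add_rpow a b hr

lemma integrable_rpow_of_le_add {Ω : Type*} [MeasurableSpace Ω] {P : Measure Ω}
    [IsProbabilityMeasure P] {g h : Ω → ℝ} {a q : ℝ} (hq : 0 < q) (ha : 0 ≤ a)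
    (hgm : Measurable g) (hg : ∀ ω, 0 ≤ g ω) (hh : ∀ ω, 0 ≤ h ω) (hgh : ∀ ω, g ω ≤ a + h ω)
    (hint : Integrable (fun ω => h ω ^ q) P) : Integrable (fun ω => g ω ^ q) P := by
  refine (((integrable_const (a ^ q)).add hint).const_mul (2 ^ q)).mono'
    (hgm.pow_const q).aestronglyMeasurable (ae_of_all _ fun ω => ?_)
  rw [Real.norm_of_nonneg (Real.rpow_nonneg (hg ω) q)]
  exact (Real.rpow_le_rpow (hg ω) (hgh ω) hq.le).trans (add_rpow_le_two_rpow_mul ha (hh ω) hq.le)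

/-- The (quasi-)triangle inequality in `L^q`, for the sum of a constant and a function: Minkowski's
inequality for `1 ≤ q`, subadditivity of `t ↦ t ^ q` and convexity of `t ↦ t ^ (1 / q)` for
`q < 1`. -/
lemma integral_rpow_le_of_le_add {Ω : Type*} [MeasurableSpace Ω] {P : Measure Ω}
    [IsProbabilityMeasure P] {g h : Ω → ℝ} {a q : ℝ} (hq : 0 < q) (ha : 0 ≤ a)
    (hg : ∀ ω, 0 ≤ g ω) (hhm : Measurable h) (hh : ∀ ω, 0 ≤ h ω) (hgh : ∀ ω, g ω ≤ a + h ω)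
    (hint : Integrable (fun ω => h ω ^ q) P) :
    (∫ ω, g ω ^ q ∂P) ^ (1 / q) ≤
      2 ^ (max (q⁻¹ - 1) 0) * (a + (∫ ω, h ω ^ q ∂P) ^ (1 / q)) := by
  have hg0 : 0 ≤ ∫ ω, g ω ^ q ∂P := integral_nonneg fun ω => Real.rpow_nonneg (hg ω) q
  have hh0 : 0 ≤ ∫ ω, h ω ^ q ∂P := integral_nonneg fun ω => Real.rpow_nonneg (hh ω) q
  have hah : ∀ ω, 0 ≤ a + h ω := fun ω => add_nonneg ha (hh ω)
  have hsumint : Integrable (fun ω => (a + h ω) ^ q) P :=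
    integrable_rpow_of_le_add hq ha (hhm.const_add a) hah hh (fun ω => le_rfl) hint
  have hmono : ∫ ω, g ω ^ q ∂P ≤ ∫ ω, (a + h ω) ^ q ∂P :=
    integral_mono_of_nonneg (ae_of_all _ fun ω => Real.rpow_nonneg (hg ω) q) hsumint
      (ae_of_all _ fun ω => Real.rpow_le_rpow (hg ω) (hgh ω) hq.le)
  rcases le_or_gt 1 q with h1 | h1
  · rw [max_eq_right (by linarith [inv_le_one_of_one_le₀ h1]), Real.rpow_zero, one_mul]
    refine (Real.rpow_le_rpow hg0 hmono (by positivity)).trans ?_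
    have hp0 : ENNReal.ofReal q ≠ 0 := (ENNReal.ofReal_pos.mpr hq).ne'
    have hL : MemLp h (ENNReal.ofReal q) P := by
      rw [← integrable_norm_rpow_iff hhm.aestronglyMeasurable hp0 ENNReal.ofReal_ne_top,
        ENNReal.toReal_ofReal hq.le]
      simpa only [Real.norm_of_nonneg (hh _)] using hint
    have hc : MemLp (fun _ : Ω => a) (ENNReal.ofReal q) P := memLp_const a
    have htri := lpNorm_add_le (g := h) hc (by simpa using h1)
    rw [lpNorm_const' hp0 ENNReal.ofReal_ne_top,
      lpNorm_eq_integral_norm_rpow_toReal hp0 ENNReal.ofReal_ne_top hL.1,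
      lpNorm_eq_integral_norm_rpow_toReal hp0 ENNReal.ofReal_ne_top (hc.add hL).1,
      ENNReal.toReal_ofReal hq.le] at htri
    simpa [Real.norm_of_nonneg (hh _), Real.norm_of_nonneg (hah _), abs_of_nonneg ha,
      abs_of_nonneg (hah _), abs_of_nonneg (hh _)] using htri
  · have h1' : 1 ≤ 1 / q := one_le_one_div hq h1.le
    rw [max_eq_left (by rw [← one_div]; linarith)]
    have hadd : ∫ ω, (a + h ω) ^ q ∂P ≤ a ^ q + ∫ ω, h ω ^ q ∂P := by
      calc _ ≤ ∫ ω, (a ^ q + h ω ^ q) ∂P :=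
            integral_mono hsumint ((integrable_const _).add hint)
              fun ω => Real.rpow_add_le_add_rpow ha (hh ω) hq.le h1.le
        _ = _ := by rw [integral_add (integrable_const _) hint]; simp
    refine (Real.rpow_le_rpow hg0 (hmono.trans hadd) (by positivity)).trans ?_
    refine (add_rpow_le_two_rpow_sub_one_mul (by positivity) hh0 h1').trans_eq ?_
    rw [← Real.rpow_mul ha, mul_one_div_cancel hq.ne', Real.rpow_one, one_div]

lemma measurable_selection {Ω ι β : Type*} [MeasurableSpace Ω] [MeasurableSpace β] [Fintype ι]
    {F : ι → Ω → β} (hF : ∀ m, Measurable (F m)) {s : Ω → ι}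
    (hs : ∀ m, MeasurableSet (s ⁻¹' {m})) : Measurable fun ω => F (s ω) ω := by
  let _ : MeasurableSpace ι := ⊤
  have h : Measurable fun z : Ω × ι => F z.2 z.1 :=
    measurable_from_prod_countable_left fun m => hF m
  exact h.comp (measurable_id.prodMk (measurable_to_countable' hs))

/-- If `δ² D ≤ M ^ (2 / p)` and `D ≥ 1`, the term of the model `(δ², D)` in the sum that defines
`Δ_p ^ q` dominates `M ^ (2 q / p)` once it is multiplied by `M δ ^ (2 q)`. -/
lemma rpow_le_mul_penalty_term {M d D p q : ℝ} (hM : 0 ≤ M) (hd : 0 < d) (hD : 1 ≤ D)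
    (hq : 0 < q) (hp : 2 * (1 + q) < p) (hdD : d * D ≤ M ^ (2 / p)) :
    (M ^ (2 / p)) ^ q ≤ M * (√d ^ (-p) * D ^ (-(p / 2 - 1 - q))) * d ^ q := by
  have hp0 : 0 < p := by linarith
  have hD0 : 0 < D := by linarith
  set L := M ^ (2 / p) with hL
  have hL0 : 0 < L := (mul_pos hd hD0).trans_le hdD
  have hML : M = L ^ q * L ^ (p / 2 - q) := by
    rw [← Real.rpow_add hL0, hL, ← Real.rpow_mul hM,
      show 2 / p * (q + (p / 2 - q)) = 1 by field_simp; ring, Real.rpow_one]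
  have hsqrt : √d ^ (-p) = d ^ (-(p / 2)) := by
    rw [Real.sqrt_eq_rpow, ← Real.rpow_mul hd.le]
    congr 1
    ring
  have hexp : 0 ≤ p / 2 - q := by linarith
  have hone : 1 ≤ (d * D) ^ (p / 2 - q) * (d ^ (-(p / 2)) * D ^ (-(p / 2 - 1 - q))) * d ^ q := by
    rw [Real.mul_rpow hd.le hD0.le,
      show d ^ (p / 2 - q) * D ^ (p / 2 - q) * (d ^ (-(p / 2)) * D ^ (-(p / 2 - 1 - q))) * d ^ q =
        (d ^ (p / 2 - q) * d ^ (-(p / 2)) * d ^ q) * (D ^ (p / 2 - q) * D ^ (-(p / 2 - 1 - q))) by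
        ring,
      ← Real.rpow_add hd, ← Real.rpow_add hd, ← Real.rpow_add hD0,
      show p / 2 - q + -(p / 2) + q = 0 by ring,
      show p / 2 - q + -(p / 2 - 1 - q) = 1 by ring, Real.rpow_zero, Real.rpow_one, one_mul]
    exact hD
  calc L ^ q = L ^ q * 1 := (mul_one _).symm
    _ ≤ L ^ q *
        ((d * D) ^ (p / 2 - q) * (d ^ (-(p / 2)) * D ^ (-(p / 2 - 1 - q))) * d ^ q) := by gcongr
    _ ≤ L ^ q * (L ^ (p / 2 - q) * (d ^ (-(p / 2)) * D ^ (-(p / 2 - 1 - q))) * d ^ q) := by gcongr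
    _ = _ := by rw [hML, hsqrt]; ring

/-! ### The observations as random vectors -/

section Observations

variable {Ω : Type*} [MeasurableSpace Ω] {P : Measure Ω} {n N : ℕ}

lemma measurable_euclVec_outer : Measurable fun v : Fin n → ℝ => euclVec n (outer v) := by
  refine Continuous.measurable ((PiLp.continuous_toLp 2 _).comp (continuous_pi fun a => ?_))
  exact (continuous_apply a.2).mul (continuous_apply a.1)

lemma memLp_euclVec_outer {v : Ω → Fin n → ℝ} (hv : Measurable v) {p : ℝ} (hp : 0 < p)
    (hint : Integrable (fun ω => ‖outer (v ω)‖ ^ p) P) :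
    MemLp (fun ω => euclVec n (outer (v ω))) (ENNReal.ofReal p) P := by
  have hm : AEStronglyMeasurable (fun ω => euclVec n (outer (v ω))) P :=
    (measurable_euclVec_outer.comp hv).aestronglyMeasurable
  rw [← integrable_norm_rpow_iff hm
    (ENNReal.ofReal_pos.mpr hp).ne' ENNReal.ofReal_ne_top, ENNReal.toReal_ofReal hp.le]
  simpa only [norm_euclVec] using hint

lemma memLp_vec_outer {v : Ω → Fin n → ℝ}
    (hv : MemLp (fun ω => euclVec n (outer (v ω))) 2 P) (a : Fin n × Fin n) :
    MemLp (fun ω => Matrix.vec (outer (v ω)) a) 2 P :=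
  (EuclideanSpace.proj (𝕜 := ℝ) a).comp_memLp' hv

/-- For a centered vector the covariance matrix is `E (x xᵀ)`. -/
lemma integral_euclVec_outer [IsProbabilityMeasure P] {v : Ω → Fin n → ℝ} (hv : Measurable v)
    (hc : ∀ j, ∫ ω, v ω j ∂P = 0) (hL : MemLp (fun ω => euclVec n (outer (v ω))) 2 P) :
    ∫ ω, euclVec n (outer (v ω)) ∂P = euclVec n (covMat P v) := by
  have hint : Integrable (fun ω => euclVec n (outer (v ω))) P := hL.integrable one_le_two
  have hcoord : ∀ j, MemLp (fun ω => v ω j) 2 P := fun j => by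
    refine (memLp_two_iff_integrable_sq
      ((measurable_pi_apply j).comp hv).aestronglyMeasurable).mpr ?_
    refine ((memLp_vec_outer hL (j, j)).integrable one_le_two).congr (ae_of_all _ fun ω => ?_)
    simp [outer, Matrix.vec, Matrix.vecMulVec_apply, sq]
  ext a
  have h := (EuclideanSpace.proj (𝕜 := ℝ) a).integral_comp_comm hint
  change ∫ ω, outer (v ω) a.2 a.1 ∂P = _ at h
  change (∫ ω, euclVec n (outer (v ω)) ∂P) a = covMat P v a.2 a.1
  refine h.symm.trans ?_
  rw [covMat, Matrix.of_apply, covariance_eq_sub (hcoord _) (hcoord _), hc, hc, mul_zero, sub_zero]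
  rfl

/-- `Tr ((Π ⊗ Π) Φ)` is the sum of the variances of the entries of `Π x xᵀ Π`. -/
lemma trace_kronecker_mul_Phi [IsProbabilityMeasure P] {v : Ω → Fin n → ℝ}
    (hL : MemLp (fun ω => euclVec n (outer (v ω))) 2 P) {Q : Matrix (Fin n) (Fin n) ℝ}
    (hQ : Qᵀ = Q) (hQQ : Q * Q = Q) :
    ((Q ⊗ₖ Q) * Phi P v).trace =
      ∑ a, Var[fun ω => Matrix.vec (Q * outer (v ω) * Q) a; P] := by
  have h := sum_variance_mulVec (memLp_vec_outer hL) (Q ⊗ₖ Q)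
  simp only [Matrix.kronecker_mulVec_vec, hQ] at h
  rw [h, ← Matrix.kroneckerMap_transpose, hQ, ← Matrix.mul_kronecker_mul, hQQ]
  rfl

lemma memLp_vec_proj {v : Ω → Fin n → ℝ}
    (hL : MemLp (fun ω => euclVec n (outer (v ω))) 2 P) (Q : Matrix (Fin n) (Fin n) ℝ)
    (a : Fin n × Fin n) : MemLp (fun ω => Matrix.vec (Q * outer (v ω) * Qᵀ) a) 2 P := by
  simp only [← Matrix.kronecker_mulVec_vec, Matrix.mulVec, dotProduct]
  exact memLp_finsetSum _ fun b _ => (memLp_vec_outer hL b).const_mul _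

lemma trace_kronecker_mul_Phi_le [IsProbabilityMeasure P] {v : Ω → Fin n → ℝ}
    (hL : MemLp (fun ω => euclVec n (outer (v ω))) 2 P) {Q : Matrix (Fin n) (Fin n) ℝ}
    (hQ : Qᵀ = Q) (hQQ : Q * Q = Q) :
    ((Q ⊗ₖ Q) * Phi P v).trace ≤ ∫ ω, ‖outer (v ω)‖ ^ 2 ∂P := by
  have hm : ∀ a, MemLp (fun ω => Matrix.vec (Q * outer (v ω) * Q) a) 2 P := fun a => by
    simpa only [hQ] using memLp_vec_proj hL Q a
  have hint : Integrable (fun ω => ‖outer (v ω)‖ ^ 2) P := by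
    have := (memLp_two_iff_integrable_sq_norm hL.1).mp hL
    simpa only [norm_euclVec] using this
  rw [trace_kronecker_mul_Phi hL hQ hQQ]
  calc _ ≤ ∑ a, ∫ ω, Matrix.vec (Q * outer (v ω) * Q) a ^ 2 ∂P :=
        Finset.sum_le_sum fun a _ => variance_le_expectation_sq (hm a).1
    _ = ∫ ω, ‖Q * outer (v ω) * Q‖ ^ 2 ∂P := by
        rw [← integral_finsetSum _ fun a _ => (hm a).integrable_sq]
        simp only [norm_sq_eq_sum]
    _ ≤ _ := integral_mono_of_nonneg (ae_of_all _ fun ω => by positivity) hint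
        (ae_of_all _ fun ω => norm_proj_mul_mul_proj_sq_le hQ hQQ _)

/-- The bias–variance decomposition of the quadratic risk of the projected empirical mean. -/
lemma integral_norm_sub_proj_empMean_sq [IsProbabilityMeasure P] [NeZero N]
    {x : Fin N → Ω → Fin n → ℝ} (hx : ∀ i, Measurable (x i)) (hind : iIndepFun x P)
    (hid : ∀ i, IdentDistrib (x i) (x 0) P P) (hc : ∀ j, ∫ ω, x 0 ω j ∂P = 0)
    (hL : ∀ i, MemLp (fun ω => euclVec n (outer (x i ω))) 2 P) {Q : Matrix (Fin n) (Fin n) ℝ}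
    (hQ : Qᵀ = Q) (hQQ : Q * Q = Q) :
    Integrable (fun ω => ‖covMat P (x 0) - Q * empMean (fun i => x i ω) * Q‖ ^ 2) P ∧
    ∫ ω, ‖covMat P (x 0) - Q * empMean (fun i => x i ω) * Q‖ ^ 2 ∂P =
      ‖covMat P (x 0) - Q * covMat P (x 0) * Q‖ ^ 2 + ((Q ⊗ₖ Q) * Phi P (x 0)).trace / N := by
  set A := covMat P (x 0) with hA
  have hm : ∀ i a, MemLp (fun ω => Matrix.vec (Q * outer (x i ω) * Q) a) 2 P := fun i a => by
    simpa only [hQ] using memLp_vec_proj (hL i) Q a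
  have hmeas : ∀ a, Measurable fun v : Fin n → ℝ => Matrix.vec (Q * outer v * Q) a := fun a => by
    simp only [Matrix.vec, Matrix.mul_apply, outer, Matrix.vecMulVec_apply]
    fun_prop
  have key := fun a => integral_sub_mean_sq (fun i => hm i a)
    (hind.comp (fun _ v => Matrix.vec (Q * outer v * Q) a) fun _ => hmeas a)
    (fun i => (hid i).comp (hmeas a)) (Matrix.vec A a)
  have hmean : ∀ a, ∫ ω, Matrix.vec (Q * outer (x 0 ω) * Q) a ∂P = Matrix.vec (Q * A * Q) a := by
    intro a
    have hlin : ∀ B, Matrix.vec (Q * B * Q) a = ∑ b, (Q ⊗ₖ Q) a b * Matrix.vec B b := fun B => by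
      nth_rewrite 2 [← hQ]
      rw [← Matrix.kronecker_mulVec_vec]
      rfl
    simp only [hlin]
    rw [integral_finsetSum _ fun b _ =>
      ((memLp_vec_outer (hL 0) b).integrable one_le_two).const_mul _]
    refine Finset.sum_congr rfl fun b _ => ?_
    rw [integral_const_mul]
    congr 1
    have h1 := (EuclideanSpace.proj (𝕜 := ℝ) b).integral_comp_comm ((hL 0).integrable one_le_two)
    rw [integral_euclVec_outer (hx 0) hc (hL 0)] at h1
    exact h1
  have hexp : ∀ ω, ‖A - Q * empMean (fun i => x i ω) * Q‖ ^ 2 = ∑ a, (Matrix.vec A a -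
      (1 / (N : ℝ)) * ∑ i, Matrix.vec (Q * outer (x i ω) * Q) a) ^ 2 := fun ω => by
    rw [norm_sq_eq_sum]
    refine Finset.sum_congr rfl fun a _ => ?_
    simp only [empMean, Matrix.mul_smul, Matrix.smul_mul, Matrix.mul_sum, Matrix.sum_mul,
      Matrix.vec, Matrix.sub_apply, Matrix.smul_apply, Matrix.sum_apply, smul_eq_mul]
  simp only [hexp]
  refine ⟨integrable_finsetSum _ fun a _ => (key a).1, ?_⟩
  rw [integral_finsetSum _ fun a _ => (key a).1, norm_sq_eq_sum,
    trace_kronecker_mul_Phi (hL 0) hQ hQQ, Finset.sum_div, ← Finset.sum_add_distrib]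
  refine Finset.sum_congr rfl fun a _ => ?_
  rw [(key a).2, hmean a]
  rfl

end Observations

/-! ### The oracle inequality -/

/-- The noise `S - Σ` has a moment of order `2 q`, of size `(M ^ (2 / p) / N) ^ q`. -/
lemma exists_integral_norm_empMean_sub_rpow_le {q p : ℝ} (hq : 0 < q) (hp : 2 * (1 + q) < p) :
    ∃ C : ℝ, 0 < C ∧
    ∀ {Ω : Type*} [MeasurableSpace Ω] {P : Measure Ω} [IsProbabilityMeasure P]
      {n N : ℕ} [NeZero N] {x : Fin N → Ω → Fin n → ℝ}, (∀ i, Measurable (x i)) →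
      iIndepFun x P → (∀ i, IdentDistrib (x i) (x 0) P P) → (∀ j, ∫ ω, x 0 ω j ∂P = 0) →
      (∀ i, MemLp (fun ω => euclVec n (outer (x i ω))) (ENNReal.ofReal p) P) →
      Measurable (fun ω => ‖empMean (fun i => x i ω) - covMat P (x 0)‖) ∧
      Integrable (fun ω => ‖empMean (fun i => x i ω) - covMat P (x 0)‖ ^ (2 * q)) P ∧
      ∫ ω, ‖empMean (fun i => x i ω) - covMat P (x 0)‖ ^ (2 * q) ∂P ≤
        C * ((∫ ω, ‖outer (x 0 ω)‖ ^ p ∂P) ^ (2 / p) / N) ^ q := by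
  obtain ⟨C, hC, hmean⟩ := exists_integral_norm_mean_sub_rpow_le hq hp
  refine ⟨C, hC, ?_⟩
  intro Ω _ P _ n N _ x hx hind hid hc hL
  have hYm : ∀ i, Measurable fun ω => euclVec n (outer (x i ω)) := fun i =>
    measurable_euclVec_outer.comp (hx i)
  have hYid : ∀ i, IdentDistrib (fun ω => euclVec n (outer (x i ω)))
      (fun ω => euclVec n (outer (x 0 ω))) P P := fun i => (hid i).comp measurable_euclVec_outer
  have hYind : iIndepFun (fun i ω => euclVec n (outer (x i ω))) P :=
    hind.comp (fun _ v => euclVec n (outer v)) fun _ => measurable_euclVec_outer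
  have hL2 : MemLp (fun ω => euclVec n (outer (x 0 ω))) 2 P := (hL 0).mono_exponent (by
    rw [← ENNReal.ofReal_ofNat]
    exact ENNReal.ofReal_le_ofReal (by linarith))
  have hYmean : ∀ i, ∫ ω, euclVec n (outer (x i ω)) ∂P = euclVec n (covMat P (x 0)) := fun i =>
    (hYid i).integral_eq.trans (integral_euclVec_outer (hx 0) hc hL2)
  have hYM : ∀ i, ∫ ω, ‖euclVec n (outer (x i ω))‖ ^ p ∂P ≤ ∫ ω, ‖outer (x 0 ω)‖ ^ p ∂P :=
    fun i => by
      have h := ((hYid i).norm.comp (measurable_id.pow_const p)).integral_eq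
      simpa only [Function.comp_def, id, norm_euclVec] using h.le
  have heY : ∀ ω, ‖empMean (fun i => x i ω) - covMat P (x 0)‖ =
      ‖(1 / (N : ℝ)) • ∑ i, euclVec n (outer (x i ω)) - euclVec n (covMat P (x 0))‖ := fun ω => by
    rw [← norm_euclVec, map_sub, empMean, map_smul, map_sum]
  have hsum : Measurable fun ω => ∑ i, euclVec n (outer (x i ω)) :=
    Finset.measurable_sum _ fun i _ => hYm i
  have hsumL : MemLp (fun ω => ∑ i, euclVec n (outer (x i ω))) (ENNReal.ofReal p) P :=
    memLp_finsetSum _ fun i _ => hL i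
  have heL : MemLp (fun ω => (1 / (N : ℝ)) • ∑ i, euclVec n (outer (x i ω)) -
      euclVec n (covMat P (x 0))) (ENNReal.ofReal p) P :=
    (hsumL.const_smul (1 / (N : ℝ))).sub (memLp_const _)
  simp only [heY]
  refine ⟨((hsum.const_smul (1 / (N : ℝ))).sub_const _).norm, ?_, ?_⟩
  · exact integrable_norm_rpow_of_memLp (by positivity)
      (heL.mono_exponent (ENNReal.ofReal_le_ofReal (by linarith)))
  · exact hmean P _ _ _ hYm hYind hL hYmean hYM

/-- The remainder term of the oracle inequality: if the models have `δ² D ≤ M ^ (2 / p)`, then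
`M ^ (2 / p)` is at most `Δ_p max δ²`, up to the constant chosen in `Δ_p`. -/
lemma mul_le_Delta_mul_iSup {ι : Type*} [Fintype ι] [Nonempty ι] {n : ℕ} {C p q M : ℝ}
    {Q : ι → Matrix (Fin n) (Fin n) ℝ}
    {Φ : Matrix (Fin n × Fin n) (Fin n × Fin n) ℝ} (hC : 0 < C) (hq : 0 < q)
    (hp : 2 * (1 + q) < p) (hM : 0 ≤ M) (hD : ∀ m, 1 ≤ dimen (Q m))
    (hd : ∀ m, 0 < deltaSq (Q m) Φ)
    (hv : ∀ m, deltaSq (Q m) Φ * dimen (Q m) ≤ M ^ (2 / p)) :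
    C ^ (1 / q) * M ^ (2 / p) ≤ Delta C p q M Q Φ * ⨆ m, deltaSq (Q m) Φ := by
  obtain ⟨m⟩ := ‹Nonempty ι›
  have hD0 : ∀ m, 0 < dimen (Q m) := fun m => one_pos.trans_le (hD m)
  set T : ι → ℝ := fun m => √(deltaSq (Q m) Φ) ^ (-p) * dimen (Q m) ^ (-(p / 2 - 1 - q)) with hT
  have hT0 : ∀ m, 0 ≤ T m := fun m =>
    mul_nonneg (Real.rpow_nonneg (Real.sqrt_nonneg _) _) (Real.rpow_nonneg (hD0 m).le _)
  have hsup : deltaSq (Q m) Φ ≤ ⨆ m, deltaSq (Q m) Φ := 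
    le_ciSup (f := fun m => deltaSq (Q m) Φ) (Set.finite_range _).bddAbove m
  have hterm := rpow_le_mul_penalty_term hM (hd m) (hD m) hq hp (hv m)
  have hsum : T m ≤ ∑ m, T m := Finset.single_le_sum (fun i _ => hT0 i) (Finset.mem_univ m)
  have hL : 0 ≤ M ^ (2 / p) := by positivity
  have hdq : 0 ≤ deltaSq (Q m) Φ ^ q := Real.rpow_nonneg (hd m).le q
  calc C ^ (1 / q) * M ^ (2 / p) = (C * (M ^ (2 / p)) ^ q) ^ (1 / q) := by
        rw [Real.mul_rpow hC.le (by positivity), ← Real.rpow_mul hL, mul_one_div_cancel hq.ne',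
          Real.rpow_one]
    _ ≤ (C * M * (∑ m, T m) * deltaSq (Q m) Φ ^ q) ^ (1 / q) := by
        refine Real.rpow_le_rpow (by positivity) ?_ (by positivity)
        calc C * (M ^ (2 / p)) ^ q ≤ C * (M * T m * deltaSq (Q m) Φ ^ q) := by gcongr
          _ ≤ C * (M * (∑ m, T m) * deltaSq (Q m) Φ ^ q) := by gcongr
          _ = _ := by ring
    _ = Delta C p q M Q Φ * deltaSq (Q m) Φ := by
        have h0 : 0 ≤ C * M * ∑ m, T m :=
          mul_nonneg (mul_nonneg hC.le hM) (Finset.sum_nonneg fun m _ => hT0 m)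
        rw [Real.mul_rpow h0 hdq, ← Real.rpow_mul (hd m).le, mul_one_div_cancel hq.ne',
          Real.rpow_one]
        rfl
    _ ≤ _ := by
        have h0 : 0 ≤ Delta C p q M Q Φ :=
          Real.rpow_nonneg (mul_nonneg (mul_nonneg hC.le hM) (Finset.sum_nonneg fun m _ => hT0 m)) _
        gcongr

theorem theorem3p3 (θ : ℝ) (hθ : 0 < θ) :
    ∃ K : ℝ, 1 < K ∧ ∀ q p : ℝ, 0 < q → 2 * (1 + q) < p → ∃ C : ℝ, 0 < C ∧
      ∀ (Ω : Type*) [MeasurableSpace Ω] (P : Measure Ω) [IsProbabilityMeasure P]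
        (n N : ℕ) [NeZero N] (x : Fin N → Ω → Fin n → ℝ)
        -- i.i.d. centered observations with `E ‖x₁ x₁ᵀ‖ ^ p < ∞`
        (_ : ∀ i, Measurable (x i)) (_ : iIndepFun x P)
        (_ : ∀ i, IdentDistrib (x i) (x 0) P P)
        (_ : ∀ j, ∫ ω, x 0 ω j ∂P = 0)
        (_ : Integrable (fun ω => ‖outer (x 0 ω)‖ ^ p) P)
        -- a finite family of design matrices, and generalized inverses of the `Gₘᵀ Gₘ`
        (ι : Type*) [Fintype ι] [Nonempty ι] (k : ι → ℕ)
        (G : ∀ m, Matrix (Fin n) (Fin (k m)) ℝ)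
        (H : ∀ m, Matrix (Fin (k m)) (Fin (k m)) ℝ)
        (_ : ∀ m, IsGenInv ((G m)ᵀ * G m) (H m))
        (Sig : Matrix (Fin n) (Fin n) ℝ) (_ : Sig = covMat P (x 0))
        (Φ : Matrix (Fin n × Fin n) (Fin n × Fin n) ℝ) (_ : Φ = Phi P (x 0))
        (Pi : ι → Matrix (Fin n) (Fin n) ℝ) (_ : ∀ m, Pi m = proj (G m) (H m))
        (_ : ∀ m, 1 ≤ dimen (Pi m)) (_ : ∀ m, 0 < deltaSq (Pi m) Φ)
        -- the least squares estimators and the penalized selection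
        (Shat : ι → Ω → Matrix (Fin n) (Fin n) ℝ)
        (_ : ∀ m ω, IsLeastSquares (G m) (fun i => x i ω) (Shat m ω))
        (mhat : Ω → ι) (_ : ∀ m, MeasurableSet (mhat ⁻¹' {m}))
        (_ : ∀ ω m, contrast (fun i => x i ω) (Shat (mhat ω) ω) + pen θ N (Pi (mhat ω)) Φ ≤
          contrast (fun i => x i ω) (Shat m ω) + pen θ N (Pi m) Φ),
        Integrable (fun ω => ‖Sig - Shat (mhat ω) ω‖ ^ (2 * q)) P ∧
        (∫ ω, ‖Sig - Shat (mhat ω) ω‖ ^ (2 * q) ∂P) ^ (1 / q) ≤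
          2 ^ (max (q⁻¹ - 1) 0) *
            (K * (⨅ m, (‖Sig - Pi m * Sig * Pi m‖ ^ 2 + deltaSq (Pi m) Φ * dimen (Pi m) / N)) +
              Delta C p q (∫ ω, ‖outer (x 0 ω)‖ ^ p ∂P) Pi Φ / N * ⨆ m, deltaSq (Pi m) Φ) ∧
        (q = 1 →
          (∀ m, Integrable (fun ω => ‖Sig - Shat m ω‖ ^ 2) P) ∧
          Integrable (fun ω => ‖Sig - Shat (mhat ω) ω‖ ^ 2) P ∧
          ∫ ω, ‖Sig - Shat (mhat ω) ω‖ ^ 2 ∂P ≤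
            K * (⨅ m, ∫ ω, ‖Sig - Shat m ω‖ ^ 2 ∂P) +
              Delta C p 1 (∫ ω, ‖outer (x 0 ω)‖ ^ p ∂P) Pi Φ / N *
                ⨆ m, deltaSq (Pi m) Φ) := by
  refine ⟨4 + 2 * θ, by linarith, fun q p hq hp => ?_⟩
  obtain ⟨C, hC, hmean⟩ := exists_integral_norm_empMean_sub_rpow_le hq hp
  -- `6 ^ q` pays for the factor `6` of the noise in the deterministic oracle inequality
  refine ⟨6 ^ q * C, by positivity, ?_⟩
  intro Ω _ P _ n N _ x hx hind hid hc hint ι _ _ k G H hH Sig hSig Φ hΦ Pi hPi hD hd Shat hLS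
    mhat hmhat hsel
  subst hSig hΦ
  have hp0 : 0 < p := by linarith
  have hN : (0 : ℝ) < N := by exact_mod_cast Nat.pos_of_ne_zero (NeZero.ne N)
  set A := covMat P (x 0) with hA
  have hAsymm : A.IsSymm := by
    ext i j
    exact covariance_comm _ _
  have hQ : ∀ m, (Pi m)ᵀ = Pi m := fun m => by rw [hPi m]; exact proj_isSymm (hH m)
  have hQQ : ∀ m, Pi m * Pi m = Pi m := fun m => by rw [hPi m]; exact proj_idem (hH m)
  have hShat : ∀ m ω, Shat m ω = Pi m * empMean (fun i => x i ω) * Pi m := fun m ω => by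
    rw [hPi m]; exact isLeastSquares_eq_proj (hH m) (hLS m ω)
  set v : ι → ℝ := fun m => deltaSq (Pi m) (Phi P (x 0)) * dimen (Pi m) with hv
  have hvtrace : ∀ m, v m = ((Pi m ⊗ₖ Pi m) * Phi P (x 0)).trace := fun m =>
    div_mul_cancel₀ _ (one_pos.trans_le (hD m)).ne'
  have hv0 : ∀ m, 0 ≤ v m := fun m => mul_nonneg (hd m).le (zero_le_one.trans (hD m))
  set M := ∫ ω, ‖outer (x 0 ω)‖ ^ p ∂P with hMdef
  have hM0 : 0 ≤ M := integral_nonneg fun ω => by positivity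
  have hYL : ∀ i, MemLp (fun ω => euclVec n (outer (x i ω))) (ENNReal.ofReal p) P := fun i =>
    ((hid i).comp measurable_euclVec_outer).memLp_iff.mpr (memLp_euclVec_outer (hx 0) hp0 hint)
  have hYL2 : ∀ i, MemLp (fun ω => euclVec n (outer (x i ω))) 2 P := fun i =>
    (hYL i).mono_exponent (by
      rw [← ENNReal.ofReal_ofNat]
      exact ENNReal.ofReal_le_ofReal (by linarith))
  -- the noise `S - Σ`
  set e : Ω → ℝ := fun ω => ‖empMean (fun i => x i ω) - A‖ with he
  obtain ⟨hem, heint, hemom⟩ : Measurable e ∧ Integrable (fun ω => e ω ^ (2 * q)) P ∧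
      ∫ ω, e ω ^ (2 * q) ∂P ≤ C * (M ^ (2 / p) / N) ^ q := hmean hx hind hid hc hYL
  have hvM : ∀ m, v m ≤ M ^ (2 / p) := fun m => by
    rw [hvtrace m]
    refine (trace_kronecker_mul_Phi_le (hYL2 0) (hQ m) (hQQ m)).trans ?_
    have h := integral_norm_rpow_le two_pos (by linarith) (hYL 0)
    simpa only [norm_euclVec, Real.rpow_two] using h
  -- pointwise bound, in the model `m` that attains the infimum
  obtain ⟨m, hm⟩ := exists_eq_ciInf_of_finite
    (f := fun m => ‖A - Pi m * A * Pi m‖ ^ 2 + deltaSq (Pi m) (Phi P (x 0)) * dimen (Pi m) / N)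
  set R := ⨅ m, (‖A - Pi m * A * Pi m‖ ^ 2 + deltaSq (Pi m) (Phi P (x 0)) * dimen (Pi m) / N)
    with hR
  have hR0 : 0 ≤ R := by
    rw [← hm]
    exact add_nonneg (sq_nonneg _) (div_nonneg (hv0 m) hN.le)
  set g : Ω → ℝ := fun ω => ‖A - Shat (mhat ω) ω‖ ^ 2 with hg
  have hgle : ∀ ω, g ω ≤ (4 + 2 * θ) * R + 6 * e ω ^ 2 := fun ω => by
    have h := norm_sub_sq_le_of_isLeastSquares (hH m) (hLS m ω) hAsymm
      (mul_nonneg (by linarith) (div_nonneg (hv0 (mhat ω)) hN.le)) (hsel ω m)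
    rw [← hPi m] at h
    refine h.trans ?_
    rw [← hm, pen]
    have h1 : 0 ≤ v m / N := div_nonneg (hv0 m) hN.le
    have h2 := sq_nonneg ‖A - Pi m * A * Pi m‖
    simp only [hv] at h1
    nlinarith [mul_nonneg hθ.le h2]
  have hgm : Measurable g := by
    refine measurable_selection (F := fun m ω => ‖A - Shat m ω‖ ^ 2) (fun m => ?_) hmhat
    simp only [hShat, norm_sq_eq_sum, empMean, outer, Matrix.vec, Matrix.sub_apply,
      Matrix.mul_apply, Matrix.smul_apply, Matrix.sum_apply, Matrix.vecMulVec_apply]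
    fun_prop
  have hpow : ∀ {a : ℝ}, 0 ≤ a → a ^ (2 * q) = (a ^ 2) ^ q := fun ha => by
    rw [Real.rpow_mul ha, Real.rpow_two]
  have hnoise : ∀ ω, (6 * e ω ^ 2) ^ q = 6 ^ q * e ω ^ (2 * q) := fun ω => by
    rw [Real.mul_rpow (by norm_num) (sq_nonneg _), hpow (norm_nonneg _)]
  have hnint : Integrable (fun ω => (6 * e ω ^ 2) ^ q) P := by
    simp only [hnoise]
    exact heint.const_mul _
  have hrisk_int : Integrable (fun ω => ‖A - Shat (mhat ω) ω‖ ^ (2 * q)) P := by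
    simp only [hpow (norm_nonneg _)]
    exact integrable_rpow_of_le_add hq (by positivity) hgm (fun ω => sq_nonneg _)
      (fun ω => by positivity) hgle hnint
  have hnmom : (∫ ω, (6 * e ω ^ 2) ^ q ∂P) ^ (1 / q) ≤
      Delta (6 ^ q * C) p q M Pi (Phi P (x 0)) / N * ⨆ m, deltaSq (Pi m) (Phi P (x 0)) := by
    simp only [hnoise]
    rw [integral_const_mul]
    have hL : 0 ≤ M ^ (2 / p) / N := by positivity
    calc (6 ^ q * ∫ ω, e ω ^ (2 * q) ∂P) ^ (1 / q)
        ≤ (6 ^ q * C * (M ^ (2 / p) / N) ^ q) ^ (1 / q) := by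
          have h0 : 0 ≤ ∫ ω, e ω ^ (2 * q) ∂P :=
            integral_nonneg fun ω => Real.rpow_nonneg (norm_nonneg _) _
          rw [mul_assoc]
          gcongr
      _ = (6 ^ q * C) ^ (1 / q) * M ^ (2 / p) / N := by
          rw [Real.mul_rpow (by positivity) (by positivity), ← Real.rpow_mul hL,
            mul_one_div_cancel hq.ne', Real.rpow_one, mul_div_assoc]
      _ ≤ (Delta (6 ^ q * C) p q M Pi (Phi P (x 0)) * ⨆ m, deltaSq (Pi m) (Phi P (x 0))) / N := by
          refine div_le_div_of_nonneg_right ?_ hN.le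
          exact mul_le_Delta_mul_iSup (by positivity) hq hp hM0 hD hd hvM
      _ = _ := by ring
  have hrisk : (∫ ω, ‖A - Shat (mhat ω) ω‖ ^ (2 * q) ∂P) ^ (1 / q) ≤
      2 ^ (max (q⁻¹ - 1) 0) * ((4 + 2 * θ) * R +
        Delta (6 ^ q * C) p q M Pi (Phi P (x 0)) / N * ⨆ m, deltaSq (Pi m) (Phi P (x 0))) := by
    simp only [hpow (norm_nonneg _)]
    refine (integral_rpow_le_of_le_add hq (by positivity) (fun ω => sq_nonneg _)
      ((hem.pow_const 2).const_mul 6) (fun ω => by positivity) hgle hnint).trans ?_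
    gcongr
  refine ⟨hrisk_int, hrisk, ?_⟩
  rintro rfl
  have hdecomp := fun m => integral_norm_sub_proj_empMean_sq hx hind hid hc hYL2 (hQ m) (hQQ m)
  have hinf : R = ⨅ m, ∫ ω, ‖A - Shat m ω‖ ^ 2 ∂P := by
    refine iInf_congr fun m => ?_
    simp only [hShat]
    rw [(hdecomp m).2, ← hvtrace m]
  rw [← hinf]
  norm_num at hrisk_int hrisk
  refine ⟨fun m => ?_, hrisk_int, ?_⟩
  · simp only [hShat]
    exact (hdecomp m).1
  · norm_num
    exact hrisk
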